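/- Let $0<q<1$, let $\alpha,\beta\in\mathbb R$ with $\alpha,\beta,\alpha-\beta\notin\mathbb Z$, and let $n\ge 0$ be an integer. Write $(a;q)_\infty=\prod_{j\ge0}(1-aq^j)$ and $w(s)=(sq;q)_\infty$. Let $h_\alpha$ be a meromorphic function on $\mathbb C\setminus\{0\}$ whose poles are simple and located exactly at the points $q^k$, $k\in\mathbb Z$, and which satisfies $h_\alpha(qz)=q^\alpha h_\alpha(z)$; let $h_\beta$ be such a function for $\beta$. Let $\Gamma\subset\mathbb C$ be a rectifiable Jordan curve with interior $\mathcal D_-$ and exterior $\mathcal D_+$ such that $0\in\mathcal D_-$, $q^k\in\mathcal D_-$ for integers $k\ge 0$, and $q^k\in\mathcal D_+$ for integers $k<0$. Let $Y_n$ be a solution of the following $3\times 3$ Riemann–Hilbert problem: (i) $Y_n$ is analytic on $\mathbb C\setminus\Gamma$; (ii) $Y_n$ has continuous boundary values $Y_{n,-}$ and $Y_{n,+}$ on $\Gamma$ from $\mathcal D_-$ and $\mathcal D_+$ respectively, and $$Y_{n,+}(s)=Y_{n,-}(s)\begin{pmatrix}1&w(s)h_\alpha(s)&w(s)h_\beta(s)\\0&1&0\\0&0&1\end{pmatrix},\qquad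 s\in\Gamma;$$ (iii) $Y_n(z)\,\mathrm{diag}(z^{-2n},z^n,z^n)=I+\mathcal O(1/z)$ as $|z|\to\infty$. Then there is exactly one matrix function $D_n$ with entire entries (the Lax matrix of the $q$-difference equation) such that, for all $z$ for which $z$ and $q^{-1}z$ both lie in $\mathcal D_-$ or both lie in $\mathcal D_+$, the matrix $Y_n(z)$ is invertible and $$D_n(z)=Y_n(q^{-1}z)\,\mathrm{diag}(1-z,\,q^\alpha,\,q^\beta)\,Y_n(z)^{-1}.$$ The eigenvalues of $D_n(0)$ are exactly $1$, $q^\alpha$ and $q^\beta$. Moreover, there are constants $\mu_1,\dots,\mu_5\in\mathbb C$ (not depending on $z$) such that $$D_n(z)=\begin{pmatrix}\mu_1-zq^{-2n}&\mu_2&\mu_3\\ \mu_4&q^{n+\alpha}&0\\ \mu_5&0&q^{n+\beta}\end{pmatrix}\qquad(z\in\mathbb C),$$ and they satisfy $$\mu_1=1+q^\alpha+q^\beta-q^{\alpha+n}-q^{\beta+n},$$ $$\mu_2\mu_4=\frac{q^{\alpha-n}(q^n-1)(q^{\alpha+n}-1)(q^{\alpha+n}-q^\beta)}{q^\beta-q^\alpha},$$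 $$\mu_3\mu_5=\frac{q^{\beta-n}(q^n-1)(q^{\beta+n}-1)(q^{\beta+n}-q^\alpha)}{q^\alpha-q^\beta}.$$ -/

import Mathlib

open Filter Topology Asymptotics

noncomputable section

namespace QLax

/-- The infinite `q`-Pochhammer symbol `(a; q)_∞ = ∏_{j ≥ 0} (1 - a q^j)`. -/
def qPochInf (q : ℝ) (a : ℂ) : ℂ := ∏' j : ℕ, (1 - a * (q : ℂ) ^ j)

/-- `w(s) = (s q; q)_∞`. -/
def weight (q : ℝ) (s : ℂ) : ℂ := qPochInf q (s * q)

/-- `h` is a function `h_α`: meromorphic on `ℂ \ {0}`, with simple poles exactly at the points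
`q ^ k`, `k ∈ ℤ`, and with `h (q z) = q ^ α h z`. -/
structure IsHFunction (q α : ℝ) (h : ℂ → ℂ) : Prop where
  analyticAt : ∀ z : ℂ, z ≠ 0 → (∀ k : ℤ, z ≠ (q : ℂ) ^ k) → AnalyticAt ℂ h z
  simplePole : ∀ k : ℤ, MeromorphicAt h ((q : ℂ) ^ k) ∧
    meromorphicOrderAt h ((q : ℂ) ^ k) = ((-1 : ℤ) : WithTop ℤ)
  map_mul : ∀ z : ℂ, z ≠ 0 → (∀ k : ℤ, z ≠ (q : ℂ) ^ k) →
    h ((q : ℂ) * z) = ((q ^ α : ℝ) : ℂ) * h z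

/-- `Γ` is (the trace of) a rectifiable Jordan curve in `ℂ`. -/
def IsRectifiableJordanCurve (Γ : Set ℂ) : Prop :=
  ∃ γ : ℝ → ℂ, ContinuousOn γ (Set.Icc 0 1) ∧ Set.InjOn γ (Set.Ico 0 1) ∧ γ 0 = γ 1 ∧
    BoundedVariationOn γ (Set.Icc 0 1) ∧ γ '' Set.Icc 0 1 = Γ

/-- The interior `D₋` of `Γ`: the points of the complement lying in a bounded component. -/
def interiorRegion (Γ : Set ℂ) : Set ℂ :=
  {z | z ∈ Γᶜ ∧ Bornology.IsBounded (connectedComponentIn Γᶜ z)}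

/-- The exterior `D₊` of `Γ`: the points of the complement lying in an unbounded component. -/
def exteriorRegion (Γ : Set ℂ) : Set ℂ :=
  {z | z ∈ Γᶜ ∧ ¬ Bornology.IsBounded (connectedComponentIn Γᶜ z)}

/-- Appropriate curves: `q ^ k` lies inside for `k ≥ 0` and outside for `k < 0`; the accumulation
point `0` of the lattice lies inside too. -/
structure IsAppropriate (q : ℝ) (Γ : Set ℂ) : Prop where
  jordan : IsRectifiableJordanCurve Γ
  zero_mem : (0 : ℂ) ∈ interiorRegion Γ
  inside : ∀ k : ℤ, 0 ≤ k → (q : ℂ) ^ k ∈ interiorRegion Γ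
  outside : ∀ k : ℤ, k < 0 → (q : ℂ) ^ k ∈ exteriorRegion Γ

/-- The jump matrix, with `h₁ = h_α` and `h₂ = h_β`. -/
def jump (q : ℝ) (h₁ h₂ : ℂ → ℂ) (s : ℂ) : Matrix (Fin 3) (Fin 3) ℂ :=
  !![1, weight q s * h₁ s, weight q s * h₂ s;
     0, 1, 0;
     0, 0, 1]

/-- `Y` solves the Riemann-Hilbert problem of degree `n` on the curve `Γ`. The values of `Y` on
`Γ` itself play no role. -/
structure IsRHPSolution (q : ℝ) (h₁ h₂ : ℂ → ℂ) (Γ : Set ℂ) (n : ℕ)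
    (Y : ℂ → Matrix (Fin 3) (Fin 3) ℂ) : Prop where
  analytic : ∀ i j, AnalyticOnNhd ℂ (fun z => Y z i j) Γᶜ
  boundary : ∃ Yminus Yplus : ℂ → Matrix (Fin 3) (Fin 3) ℂ,
    ContinuousOn Yminus Γ ∧ ContinuousOn Yplus Γ ∧
    ∀ s ∈ Γ, Tendsto Y (𝓝[interiorRegion Γ] s) (𝓝 (Yminus s)) ∧
      Tendsto Y (𝓝[exteriorRegion Γ] s) (𝓝 (Yplus s)) ∧
      Yplus s = Yminus s * jump q h₁ h₂ s
  decay : ∀ i j,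
    (fun z : ℂ => (Y z * Matrix.diagonal ![z ^ (-2 * (n : ℤ)), z ^ n, z ^ n] - 1) i j)
      =O[Bornology.cobounded ℂ] fun z => z⁻¹

/-- `T(z) = Y(z / q) diag(1 - z, q ^ α, q ^ β)`. -/
def shifted (q α β : ℝ) (Y : ℂ → Matrix (Fin 3) (Fin 3) ℂ) (z : ℂ) :
    Matrix (Fin 3) (Fin 3) ℂ :=
  Y ((q : ℂ)⁻¹ * z) * Matrix.diagonal ![1 - z, ((q ^ α : ℝ) : ℂ), ((q ^ β : ℝ) : ℂ)]

/-- `D` is the Lax matrix of `Y`: the entire matrix function with `D(z) = T(z) Y(z)⁻¹`. In `T` the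
function `Y` is continued analytically from either side of the curve, so the formula is read with
the values of `Y` itself where `z` and `z / q` lie on the same side of `Γ`; the entries of `D`
being entire, this determines `D` everywhere. -/
structure IsLaxMatrix (q α β : ℝ) (Γ : Set ℂ) (Y D : ℂ → Matrix (Fin 3) (Fin 3) ℂ) : Prop where
  entire : ∀ i j, Differentiable ℂ fun z => D z i j
  eq_of_inside : ∀ z : ℂ, z ∈ interiorRegion Γ → (q : ℂ)⁻¹ * z ∈ interiorRegion Γ →
    IsUnit (Y z).det ∧ D z = shifted q α β Y z * (Y z)⁻¹
  eq_of_outside : ∀ z : ℂ, z ∈ exteriorRegion Γ → (q : ℂ)⁻¹ * z ∈ exteriorRegion Γ →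
    IsUnit (Y z).det ∧ D z = shifted q α β Y z * (Y z)⁻¹

end QLax

end

/-!
Since `w(s) = (sq; q)_∞` vanishes at `q ^ k` for `k < 0`, the products `w h_α` and `w h_β` have only
removable singularities outside the curve. So the jump matrix `J` continues analytically to a
neighbourhood of `Γ ∪ D₊` (`analyticAt_jumpEntry`), and the function `E` given by `Y` on `D₋` and by
`Y J⁻¹` on `D₊` is continuous across `Γ`. A rectifiable curve is removable for continuous functions
(`IsRectifiableJordanCurve.differentiable_of_differentiableOn_compl`), hence `E` is entire
(`IsRHPSolution.exists_entire`). The Jordan curve theorem plays no role: `E` is continuous along `Γ`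
by hypothesis, and each point off `Γ` lies in a bounded or an unbounded component. Now `det E` is
entire and tends to `1` at infinity, so it is `1`.

The functional equations `w(z/q) = (1 - z) w(z)` and `h(qz) = q ^ α h(z)` say that
`J(z/q) diag(1 - z, q ^ α, q ^ β) = diag(1 - z, q ^ α, q ^ β) J(z)`. Therefore
`E(z/q) diag(1 - z, q ^ α, q ^ β) E(z)⁻¹`, which is entire, is the Lax matrix on both sides of the
curve (`isLaxMatrix_laxMatrix`). It is the only one, because the values near `0` are prescribed.

With `M(z) = Y(z) diag(z⁻²ⁿ, zⁿ, zⁿ) = I + O(1/z)`, the Lax matrix near infinity is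
`M(z/q) diag(q⁻²ⁿ (1 - z), qⁿ q ^ α, qⁿ q ^ β) M(z)⁻¹`. Its difference from the diagonal matrix in
the middle is `O(1)`, and `O(1/z)` in the lower right `2 × 2` block, so Liouville's theorem gives
the shape of `D` (`IsLaxMatrix.exists_const`). At `z = 0` the Lax matrix is conjugate to
`diag(1, q ^ α, q ^ β)`. This yields the eigenvalues, and comparing characteristic polynomials at
`q ^ (n + α)` and at `q ^ (n + β)` yields the products of the off-diagonal entries
(`entries_of_charpoly`).
-/

noncomputable section

namespace QLax

/-! ### Removability of rectifiable curves -/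

open Complex in
/-- The integral of `f` around the boundary of the rectangle with sides `[a, b]` and `[c, d]`. The
orientation is positive when `a ≤ b` and `c ≤ d`. -/
def rectIntegral (f : ℂ → ℂ) (a b c d : ℝ) : ℂ :=
  (∫ x : ℝ in a..b, f (x + c * I)) - (∫ x : ℝ in a..b, f (x + d * I)) +
    I * (∫ y : ℝ in c..d, f (b + y * I)) - I * (∫ y : ℝ in c..d, f (a + y * I))

lemma rectIntegral_add_horizontal {f : ℂ → ℂ} (hf : Continuous f) (a b e c d : ℝ) :
    rectIntegral f a b c d + rectIntegral f b e c d = rectIntegral f a e c d := by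
  have h (t : ℝ) : (∫ x : ℝ in a..b, f (x + t * Complex.I)) +
      ∫ x : ℝ in b..e, f (x + t * Complex.I) = ∫ x : ℝ in a..e, f (x + t * Complex.I) :=
    intervalIntegral.integral_add_adjacent_intervals
      (Continuous.intervalIntegrable (by fun_prop) _ _)
      (Continuous.intervalIntegrable (by fun_prop) _ _)
  simp only [rectIntegral, ← h]
  ring

lemma rectIntegral_add_vertical {f : ℂ → ℂ} (hf : Continuous f) (a b c d e : ℝ) :
    rectIntegral f a b c d + rectIntegral f a b d e = rectIntegral f a b c e := by
  have h (t : ℝ) : (∫ y : ℝ in c..d, f (t + y * Complex.I)) +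
      ∫ y : ℝ in d..e, f (t + y * Complex.I) = ∫ y : ℝ in c..e, f (t + y * Complex.I) :=
    intervalIntegral.integral_add_adjacent_intervals
      (Continuous.intervalIntegrable (by fun_prop) _ _)
      (Continuous.intervalIntegrable (by fun_prop) _ _)
  simp only [rectIntegral, ← h]
  ring

lemma rectIntegral_eq_sum_grid {f : ℂ → ℂ} (hf : Continuous f) (x y : ℕ → ℝ) (N M : ℕ) :
    rectIntegral f (x 0) (x N) (y 0) (y M) =
      ∑ p ∈ Finset.range N ×ˢ Finset.range M,
        rectIntegral f (x p.1) (x (p.1 + 1)) (y p.2) (y (p.2 + 1)) := by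
  have hrow (i : ℕ) : ∑ j ∈ Finset.range M, rectIntegral f (x i) (x (i + 1)) (y j) (y (j + 1)) =
      rectIntegral f (x i) (x (i + 1)) (y 0) (y M) := by
    induction M with
    | zero => simp [rectIntegral]
    | succ m ih => rw [Finset.sum_range_succ, ih, rectIntegral_add_vertical hf]
  rw [Finset.sum_product]
  simp only [hrow]
  induction N with
  | zero => simp [rectIntegral]
  | succ m ih => rw [Finset.sum_range_succ, ← ih, rectIntegral_add_horizontal hf]

lemma rectIntegral_sub_const {f : ℂ → ℂ} (hf : Continuous f) (k : ℂ) (a b c d : ℝ) :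
    rectIntegral (fun z => f z - k) a b c d = rectIntegral f a b c d := by
  have h₁ (t : ℝ) : (∫ x : ℝ in a..b, (f (x + t * Complex.I) - k)) =
      (∫ x : ℝ in a..b, f (x + t * Complex.I)) - (b - a) * k := by
    rw [intervalIntegral.integral_sub (Continuous.intervalIntegrable (by fun_prop) _ _)
      (Continuous.intervalIntegrable (by fun_prop) _ _)]
    simp
  have h₂ (t : ℝ) : (∫ y : ℝ in c..d, (f (t + y * Complex.I) - k)) =
      (∫ y : ℝ in c..d, f (t + y * Complex.I)) - (d - c) * k := by
    rw [intervalIntegral.integral_sub (Continuous.intervalIntegrable (by fun_prop) _ _)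
      (Continuous.intervalIntegrable (by fun_prop) _ _)]
    simp
  simp only [rectIntegral, h₁, h₂]
  ring

/-- The boundary integral is small when `f` has small oscillation on the rectangle, constants having
zero integral. -/
lemma norm_rectIntegral_le_of_norm_sub_le {f : ℂ → ℂ} (hf : Continuous f) {a b c d ε : ℝ} (k : ℂ)
    (h : ∀ z ∈ Set.uIcc a b ×ℂ Set.uIcc c d, ‖f z - k‖ ≤ ε) :
    ‖rectIntegral f a b c d‖ ≤ 2 * ε * (|b - a| + |d - c|) := by
  rw [← rectIntegral_sub_const hf k]
  have h₁ (t : ℝ) (ht : t ∈ Set.uIcc c d) :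
      ‖∫ x : ℝ in a..b, (f (x + t * Complex.I) - k)‖ ≤ ε * |b - a| :=
    intervalIntegral.norm_integral_le_of_norm_le_const fun x hx =>
      h _ (by simpa [Complex.mem_reProdIm] using ⟨Set.uIoc_subset_uIcc hx, ht⟩)
  have h₂ (t : ℝ) (ht : t ∈ Set.uIcc a b) :
      ‖Complex.I * ∫ y : ℝ in c..d, (f (t + y * Complex.I) - k)‖ ≤ ε * |d - c| := by
    rw [norm_mul, Complex.norm_I, one_mul]
    exact intervalIntegral.norm_integral_le_of_norm_le_const fun x hx =>
      h _ (by simpa [Complex.mem_reProdIm] using ⟨ht, Set.uIoc_subset_uIcc hx⟩)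
  have := h₁ c Set.left_mem_uIcc
  have := h₁ d Set.right_mem_uIcc
  have := h₂ a Set.left_mem_uIcc
  have := h₂ b Set.right_mem_uIcc
  unfold rectIntegral
  refine (norm_sub_le _ _).trans ((add_le_add_left (norm_add_le _ _) _).trans
    ((add_le_add_left (add_le_add_left (norm_sub_le _ _) _) _).trans ?_))
  linarith

/-- A rectifiable curve carries a bounded function `v`, the arc length from the starting point, such
that `v` increases distances. -/
lemma IsRectifiableJordanCurve.exists_dist_le {Γ : Set ℂ} (hΓ : IsRectifiableJordanCurve Γ) :
    ∃ (L : ℝ) (v : ℂ → ℝ), (∀ p ∈ Γ, 0 ≤ v p ∧ v p ≤ L) ∧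
      ∀ p ∈ Γ, ∀ p' ∈ Γ, dist p p' ≤ |v p - v p'| := by
  obtain ⟨γ, -, -, -, hbv, rfl⟩ := hΓ
  have hloc := hbv.locallyBoundedVariationOn
  have h0 : (0 : ℝ) ∈ Set.Icc (0 : ℝ) 1 := by simp
  -- The length is measured up to a chosen parameter `t p` of each point `p`.
  choose! t ht htp using fun p (hp : p ∈ γ '' Set.Icc 0 1) => hp
  have key : ∀ s ∈ Set.Icc (0 : ℝ) 1, ∀ s' ∈ Set.Icc (0 : ℝ) 1, s ≤ s' →
      dist (γ s) (γ s') ≤ |variationOnFromTo γ (Set.Icc 0 1) 0 s -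
        variationOnFromTo γ (Set.Icc 0 1) 0 s'| := by
    intro s hs s' hs' hss
    rw [abs_sub_comm, variationOnFromTo.sub_right hloc h0 hs' hs,
      variationOnFromTo.eq_of_le _ _ hss, abs_of_nonneg ENNReal.toReal_nonneg, dist_edist]
    exact ENNReal.toReal_mono (hloc s s' hs hs')
      (eVariationOn.edist_le _ ⟨hs, le_rfl, hss⟩ ⟨hs', hss, le_rfl⟩)
  refine ⟨(eVariationOn γ (Set.Icc 0 1)).toReal,
    fun p => variationOnFromTo γ (Set.Icc 0 1) 0 (t p), fun p hp => ⟨?_, ?_⟩, fun p hp p' hp' => ?_⟩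
  · exact variationOnFromTo.nonneg_of_le _ _ (ht p hp).1
  · exact (le_abs_self _).trans (variationOnFromTo.abs_le_eVariationOn hbv)
  · have hd : dist p p' = dist (γ (t p)) (γ (t p')) := by rw [htp p hp, htp p' hp']
    rw [hd]
    rcases le_total (t p) (t p') with h | h
    · exact key _ (ht p hp) _ (ht p' hp') h
    · rw [dist_comm, abs_sub_comm]
      exact key _ (ht p' hp') _ (ht p hp) h

/-- Two points of an arithmetic progression of step `h` whose adjacent intervals contain points at
distance at most `|h|` have indices differing by at most `3`. -/
lemma index_sub_le_of_mem_uIcc {a h u u' : ℝ} {i i' : ℕ} (hh : h ≠ 0)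
    (hu : u ∈ Set.uIcc (a + i * h) (a + (i + 1 : ℕ) * h))
    (hu' : u' ∈ Set.uIcc (a + i' * h) (a + (i' + 1 : ℕ) * h)) (huu : |u - u'| ≤ |h|) :
    i ≤ i' + 3 := by
  have e₁ : |u - (a + i * h)| ≤ |h| := by
    have := Set.abs_sub_left_of_mem_uIcc hu
    push_cast at this
    rwa [show a + ((i : ℝ) + 1) * h - (a + i * h) = h by ring] at this
  have e₂ : |u' - (a + i' * h)| ≤ |h| := by
    have := Set.abs_sub_left_of_mem_uIcc hu'
    push_cast at this
    rwa [show a + ((i' : ℝ) + 1) * h - (a + i' * h) = h by ring] at this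
  have e₃ : |((i : ℝ) - i') * h| ≤ 3 * |h| := by
    rw [show ((i : ℝ) - i') * h = (u - u') + (u' - (a + i' * h)) - (u - (a + i * h)) by ring]
    refine (abs_sub _ _).trans ?_
    have := abs_add_le (u - u') (u' - (a + i' * h))
    linarith
  rw [abs_mul] at e₃
  have e₄ := le_of_mul_le_mul_right e₃ (abs_pos.2 hh)
  have e₅ := (le_abs_self _).trans e₄
  have : (i : ℝ) ≤ i' + 3 := by linarith
  exact_mod_cast this

open Classical in
/-- A curve of length `L` meets at most `49 (L / δ + 1)` cells of a grid whose cells have sides of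
length at least `δ`: cutting the curve into arcs of length `δ`, each arc meets at most `7 × 7`
cells. -/
lemma card_cells_meeting_le {Γ : Set ℂ} {L : ℝ} {v : ℂ → ℝ} (hv : ∀ p ∈ Γ, 0 ≤ v p ∧ v p ≤ L)
    (hd : ∀ p ∈ Γ, ∀ p' ∈ Γ, dist p p' ≤ |v p - v p'|) {a c h k δ : ℝ} (hδ : 0 < δ)
    (hh : δ ≤ |h|) (hk : δ ≤ |k|) (S : Finset (ℕ × ℕ))
    (hS : ∀ p ∈ S, ((Set.uIcc (a + p.1 * h) (a + (p.1 + 1 : ℕ) * h) ×ℂ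
      Set.uIcc (c + p.2 * k) (c + (p.2 + 1 : ℕ) * k)) ∩ Γ).Nonempty) :
    S.card ≤ 49 * (⌊L / δ⌋₊ + 1) := by
  choose! P hP using hS
  have hh0 : h ≠ 0 := abs_pos.1 (hδ.trans_le hh)
  have hk0 : k ≠ 0 := abs_pos.1 (hδ.trans_le hk)
  -- `F p` is the index of the arc containing a chosen point of the curve in the cell `p`.
  set F : ℕ × ℕ → ℕ := fun p => ⌊v (P p) / δ⌋₊ with hF
  have himg : (S.image F).card ≤ ⌊L / δ⌋₊ + 1 := by
    rw [← Finset.card_range (⌊L / δ⌋₊ + 1)]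
    refine Finset.card_le_card fun m hm => ?_
    obtain ⟨p, hp, rfl⟩ := Finset.mem_image.1 hm
    rw [Finset.mem_range, Nat.lt_succ_iff]
    exact Nat.floor_le_floor (by gcongr; exact (hv _ (hP p hp).2).2)
  refine (Finset.card_le_mul_card_image (f := F) S 49 ?_).trans (by gcongr)
  intro m hm
  obtain ⟨p₀, hp₀, rfl⟩ := Finset.mem_image.1 hm
  have hclose : ∀ p ∈ S, ∀ p' ∈ S, F p = F p' → p.1 ≤ p'.1 + 3 ∧ p.2 ≤ p'.2 + 3 := by
    intro p hp p' hp' hpp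
    have h₁ := (hP p hp).1
    have h₂ := (hP p' hp').1
    rw [Complex.mem_reProdIm] at h₁ h₂
    have hdist : ‖P p - P p'‖ ≤ δ := by
      rw [← dist_eq_norm]
      refine (hd _ (hP p hp).2 _ (hP p' hp').2).trans ?_
      have n₁ := Nat.floor_le (div_nonneg (hv _ (hP p hp).2).1 hδ.le)
      have n₂ := Nat.floor_le (div_nonneg (hv _ (hP p' hp').2).1 hδ.le)
      have n₃ := Nat.lt_floor_add_one (v (P p) / δ)
      have n₄ := Nat.lt_floor_add_one (v (P p') / δ)
      simp only [hF] at hpp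
      rw [hpp] at n₁ n₃
      have : |v (P p) / δ - v (P p') / δ| ≤ 1 := by
        rw [abs_le]; constructor <;> linarith
      rwa [← sub_div, abs_div, abs_of_pos hδ, div_le_one hδ] at this
    refine ⟨index_sub_le_of_mem_uIcc hh0 h₁.1 h₂.1 ?_, index_sub_le_of_mem_uIcc hk0 h₁.2 h₂.2 ?_⟩
    · rw [← Complex.sub_re]
      exact (Complex.abs_re_le_norm _).trans (hdist.trans hh)
    · rw [← Complex.sub_im]
      exact (Complex.abs_im_le_norm _).trans (hdist.trans hk)
  calc (S.filter fun p => F p = F p₀).card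
      ≤ (Finset.Icc (p₀.1 - 3) (p₀.1 + 3) ×ˢ Finset.Icc (p₀.2 - 3) (p₀.2 + 3)).card := by
        refine Finset.card_le_card fun p hp => ?_
        obtain ⟨hp, hpe⟩ := Finset.mem_filter.1 hp
        have c₁ := hclose p hp p₀ hp₀ hpe
        have c₂ := hclose p₀ hp₀ p hp hpe.symm
        simp only [Finset.mem_product, Finset.mem_Icc]
        omega
    _ ≤ 7 * 7 := by
        rw [Finset.card_product, Nat.card_Icc, Nat.card_Icc]
        gcongr <;> omega
    _ = 49 := rfl

lemma rectIntegral_eq_zero_of_differentiableOn {f : ℂ → ℂ} {a b c d : ℝ}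
    (hf : DifferentiableOn ℂ f (Set.uIcc a b ×ℂ Set.uIcc c d)) : rectIntegral f a b c d = 0 := by
  simpa [rectIntegral] using Complex.integral_boundary_rect_eq_zero_of_differentiableOn f
    ⟨a, c⟩ ⟨b, d⟩ hf

lemma uIcc_grid_subset {a b : ℝ} {N i : ℕ} (hi : i < N) :
    Set.uIcc (a + i * ((b - a) / N)) (a + (i + 1 : ℕ) * ((b - a) / N)) ⊆ Set.uIcc a b := by
  have hN : (0 : ℝ) < N := by exact_mod_cast (Nat.zero_le i).trans_lt hi
  have key : ∀ j : ℕ, j ≤ N → a + j * ((b - a) / N) ∈ Set.uIcc a b := by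
    intro j hj
    rw [← segment_eq_uIcc, segment_eq_image']
    refine ⟨j / N, ⟨by positivity, ?_⟩, ?_⟩
    · rw [div_le_one hN]
      exact_mod_cast hj
    · simp only [smul_eq_mul]
      ring
  exact Set.uIcc_subset_uIcc (key i hi.le) (key (i + 1) hi)

/-- The boundary integral over a rectangle vanishes for a continuous function that is holomorphic
off a closed set of finite length. -/
lemma rectIntegral_eq_zero_of_differentiableOn_compl {Γ : Set ℂ} {L : ℝ} {v : ℂ → ℝ}
    (hv : ∀ p ∈ Γ, 0 ≤ v p ∧ v p ≤ L)
    (hdist : ∀ p ∈ Γ, ∀ p' ∈ Γ, dist p p' ≤ |v p - v p'|) {f : ℂ → ℂ} (hf : Continuous f)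
    (hfd : DifferentiableOn ℂ f Γᶜ) (a b c d : ℝ) : rectIntegral f a b c d = 0 := by
  classical
  rcases eq_or_ne a b with rfl | hab
  · simp [rectIntegral]
  rcases eq_or_ne c d with rfl | hcd
  · simp [rectIntegral]
  have hW : 0 < |b - a| := abs_pos.2 (sub_ne_zero.2 hab.symm)
  have hH : 0 < |d - c| := abs_pos.2 (sub_ne_zero.2 hcd.symm)
  rcases Γ.eq_empty_or_nonempty with rfl | ⟨p₀, hp₀⟩
  · exact rectIntegral_eq_zero_of_differentiableOn (hfd.mono (by simp))
  have hL : 0 ≤ L := (hv p₀ hp₀).1.trans (hv p₀ hp₀).2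
  set R := |b - a| + |d - c| with hR
  set m := min |b - a| |d - c| with hm
  have hm0 : 0 < m := lt_min hW hH
  have hR0 : 0 < R := by positivity
  set K := 98 * (L / m * R + R) with hK
  have hK0 : 0 < K := by positivity
  -- Only the cells meeting `Γ` contribute. There are `O(N)` of them, each contributes `O(ε / N)`.
  have main : ∀ ε > 0, ‖rectIntegral f a b c d‖ ≤ K * ε := by
    intro ε hε
    have hcomp : IsCompact (Set.uIcc a b ×ℂ Set.uIcc c d) := isCompact_uIcc.reProdIm isCompact_uIcc
    obtain ⟨δ₀, hδ₀, huc⟩ := Metric.uniformContinuousOn_iff_le.1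
      (hcomp.uniformContinuousOn_of_continuous hf.continuousOn) ε hε
    obtain ⟨N, hN⟩ := exists_nat_gt (R / δ₀)
    have hN0 : (0 : ℝ) < N := (by positivity : 0 ≤ R / δ₀).trans_lt hN
    have hN1 : (1 : ℝ) ≤ N := by
      exact_mod_cast Nat.one_le_iff_ne_zero.2 (by rintro rfl; simp at hN0)
    have hRN : R / N ≤ δ₀ := by
      rw [div_le_iff₀ hN0]
      rw [div_lt_iff₀ hδ₀] at hN
      linarith
    set h := (b - a) / N with hh
    set k := (d - c) / N with hk
    have hah : |h| = |b - a| / N := by rw [hh, abs_div, abs_of_pos hN0]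
    have hak : |k| = |d - c| / N := by rw [hk, abs_div, abs_of_pos hN0]
    have hhk : |h| + |k| = R / N := by rw [hah, hak, hR, add_div]
    set x : ℕ → ℝ := fun i => a + i * h with hx
    set y : ℕ → ℝ := fun j => c + j * k with hy
    have hgrid := rectIntegral_eq_sum_grid hf x y N N
    have hxN : x N = b := by simp only [hx, hh]; field_simp; ring
    have hyN : y N = d := by simp only [hy, hk]; field_simp; ring
    have hx0 : x 0 = a := by simp [hx]
    have hy0 : y 0 = c := by simp [hy]
    rw [hxN, hyN, hx0, hy0] at hgrid
    set S := (Finset.range N ×ˢ Finset.range N).filter fun p =>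
      ((Set.uIcc (x p.1) (x (p.1 + 1)) ×ℂ Set.uIcc (y p.2) (y (p.2 + 1))) ∩ Γ).Nonempty with hS
    have hzero : rectIntegral f a b c d =
        ∑ p ∈ S, rectIntegral f (x p.1) (x (p.1 + 1)) (y p.2) (y (p.2 + 1)) := by
      rw [hgrid, hS, Finset.sum_filter_of_ne]
      intro p _ hne
      by_contra hemp
      refine hne (rectIntegral_eq_zero_of_differentiableOn (hfd.mono ?_))
      exact fun z hz hzΓ => hemp ⟨z, hz, hzΓ⟩
    have hcard : S.card ≤ 49 * (⌊L / (m / N)⌋₊ + 1) := by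
      refine card_cells_meeting_le hv hdist (a := a) (c := c) (h := h) (k := k) (by positivity)
        ?_ ?_ S fun p hp => (Finset.mem_filter.1 hp).2
      · rw [hah]; gcongr; exact min_le_left _ _
      · rw [hak]; gcongr; exact min_le_right _ _
    have hcell : ∀ p ∈ S, ‖rectIntegral f (x p.1) (x (p.1 + 1)) (y p.2) (y (p.2 + 1))‖ ≤
        2 * ε * (R / N) := by
      intro p hp
      obtain ⟨hp, -⟩ := Finset.mem_filter.1 hp
      rw [Finset.mem_product, Finset.mem_range, Finset.mem_range] at hp
      have hxs : x (p.1 + 1) - x p.1 = h := by simp only [hx]; push_cast; ring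
      have hys : y (p.2 + 1) - y p.2 = k := by simp only [hy]; push_cast; ring
      have hsub : Set.uIcc (x p.1) (x (p.1 + 1)) ×ℂ Set.uIcc (y p.2) (y (p.2 + 1)) ⊆
          Set.uIcc a b ×ℂ Set.uIcc c d := fun z hz =>
        ⟨uIcc_grid_subset hp.1 hz.1, uIcc_grid_subset hp.2 hz.2⟩
      have := norm_rectIntegral_le_of_norm_sub_le hf (a := x p.1) (b := x (p.1 + 1))
        (c := y p.2) (d := y (p.2 + 1)) (ε := ε) (f (⟨x p.1, y p.2⟩ : ℂ)) ?_
      · rwa [hxs, hys, hhk] at this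
      · intro z hz
        rw [← dist_eq_norm]
        refine huc _ (hsub hz) _ (hsub ⟨Set.left_mem_uIcc, Set.left_mem_uIcc⟩) ?_
        refine le_trans ?_ hRN
        rw [← hhk, dist_eq_norm]
        refine (Complex.norm_le_abs_re_add_abs_im _).trans (add_le_add ?_ ?_)
        · rw [← hxs, Complex.sub_re]
          exact Set.abs_sub_left_of_mem_uIcc hz.1
        · rw [← hys, Complex.sub_im]
          exact Set.abs_sub_left_of_mem_uIcc hz.2
    calc ‖rectIntegral f a b c d‖ ≤ S.card * (2 * ε * (R / N)) := by
          rw [hzero, ← nsmul_eq_mul]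
          exact norm_sum_le_of_le _ hcell |>.trans (by simp)
      _ ≤ (49 * (L / (m / N) + 1)) * (2 * ε * (R / N)) := by
          gcongr
          refine (Nat.cast_le.2 hcard).trans ?_
          push_cast
          gcongr
          exact Nat.floor_le (by positivity)
      _ = 98 * ε * (L / m * R + R / N) := by field_simp; ring
      _ ≤ 98 * ε * (L / m * R + R) := by
          gcongr
          exact div_le_self hR0.le hN1
      _ = K * ε := by rw [hK]; ring
  by_contra hne
  have hpos := norm_pos_iff.2 hne
  have := main (‖rectIntegral f a b c d‖ / (2 * K)) (by positivity)
  rw [show K * (‖rectIntegral f a b c d‖ / (2 * K)) = ‖rectIntegral f a b c d‖ / 2 by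
    field_simp] at this
  linarith

/-- Painlevé's theorem: a rectifiable curve is removable for continuous functions that are
holomorphic off the curve. -/
theorem IsRectifiableJordanCurve.differentiable_of_differentiableOn_compl {Γ : Set ℂ}
    (hΓ : IsRectifiableJordanCurve Γ) {f : ℂ → ℂ} (hf : Continuous f)
    (hfd : DifferentiableOn ℂ f Γᶜ) : Differentiable ℂ f := by
  obtain ⟨L, v, hv, hdist⟩ := hΓ.exists_dist_le
  rw [← differentiableOn_univ, ← Complex.isConservativeOn_and_continuousOn_iff_isDifferentiableOn
    isOpen_univ]
  refine ⟨fun z w _ => ?_, hf.continuousOn⟩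
  rw [← add_eq_zero_iff_eq_neg, Complex.wedgeIntegral_add_wedgeIntegral_eq]
  exact rectIntegral_eq_zero_of_differentiableOn_compl hv hdist hf hfd z.re w.re z.im w.im

/-! ### The weight and the continued jump matrix -/

lemma multipliable_one_sub_mul_pow {q : ℝ} (hq0 : 0 < q) (hq1 : q < 1) (a : ℂ) :
    Multipliable fun j : ℕ => 1 - a * (q : ℂ) ^ j := by
  simp only [sub_eq_add_neg]
  refine multipliable_one_add_of_summable ?_
  simp only [norm_neg, norm_mul, norm_pow, Complex.norm_real, Real.norm_eq_abs, abs_of_pos hq0]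
  exact (summable_geometric_of_lt_one hq0.le hq1).mul_left _

lemma differentiable_qPochInf {q : ℝ} (hq0 : 0 < q) (hq1 : q < 1) :
    Differentiable ℂ (qPochInf q) := by
  intro a
  have hopen : IsOpen (Metric.ball (0 : ℂ) (‖a‖ + 1)) := Metric.isOpen_ball
  have hprod := Summable.hasProdLocallyUniformlyOn_nat_one_add
    (f := fun j (z : ℂ) => -(z * (q : ℂ) ^ j)) hopen
    ((summable_geometric_of_lt_one hq0.le hq1).mul_left (‖a‖ + 1))
    (.of_forall fun j z hz => by
      rw [mem_ball_zero_iff] at hz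
      simp only [norm_neg, norm_mul, norm_pow, Complex.norm_real, Real.norm_eq_abs,
        abs_of_pos hq0]
      gcongr)
    (fun j => by fun_prop)
  have hd := hprod.differentiableOn
    (.of_forall fun s => by
      simpa [Finset.prod_fn] using DifferentiableOn.finsetProd (fun _ _ ↦ by fun_prop)) hopen
  have ha : Metric.ball (0 : ℂ) (‖a‖ + 1) ∈ 𝓝 a := hopen.mem_nhds (by simp)
  refine (hd.differentiableAt ha).congr_of_eventuallyEq (.of_forall fun z => ?_)
  simp only [qPochInf, sub_eq_add_neg]

lemma differentiable_weight {q : ℝ} (hq0 : 0 < q) (hq1 : q < 1) : Differentiable ℂ (weight q) :=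
  (differentiable_qPochInf hq0 hq1).comp (differentiable_id.mul_const _)

lemma weight_inv_mul {q : ℝ} (hq0 : 0 < q) (hq1 : q < 1) (z : ℂ) :
    weight q ((q : ℂ)⁻¹ * z) = (1 - z) * weight q z := by
  have hq : (q : ℂ) ≠ 0 := by exact_mod_cast hq0.ne'
  have h₁ : (q : ℂ)⁻¹ * z * q = z := by field_simp
  unfold weight
  rw [h₁]
  unfold qPochInf
  have h₂ (j : ℕ) : z * (q : ℂ) ^ (j + 1) = z * q * (q : ℂ) ^ j := by ring
  rw [tprod_eq_zero_mul' (by simpa only [h₂] using multipliable_one_sub_mul_pow hq0 hq1 (z * q))]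
  simp only [h₂, pow_zero, mul_one]

lemma weight_zpow_eq_zero {q : ℝ} (hq0 : 0 < q) {k : ℤ} (hk : k < 0) :
    weight q ((q : ℂ) ^ k) = 0 := by
  have hq : (q : ℂ) ≠ 0 := by exact_mod_cast hq0.ne'
  refine tprod_of_exists_eq_zero ⟨(-k - 1).toNat, ?_⟩
  rw [← zpow_natCast, Int.toNat_of_nonneg (by omega), ← zpow_add_one₀ hq, ← zpow_add₀ hq,
    show k + 1 + (-k - 1) = 0 by ring, zpow_zero, sub_self]

/-- Replacing the values of `f` by its limits removes a removable singularity. -/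
lemma analyticAt_limUnder_nhdsNE {f : ℂ → ℂ} {x : ℂ} (hf : MeromorphicAt f x)
    (ho : 0 ≤ meromorphicOrderAt f x) : AnalyticAt ℂ (fun z => limUnder (𝓝[≠] z) f) x := by
  obtain ⟨G, hG, hfG⟩ := hf.meromorphicOrderAt_nonneg_iff.1 ho
  refine hG.congr ?_
  have hlim {z : ℂ} (hGz : AnalyticAt ℂ G z) (h : f =ᶠ[𝓝[≠] z] G) :
      G z = limUnder (𝓝[≠] z) f :=
    ((hGz.continuousAt.tendsto.mono_left nhdsWithin_le_nhds).congr' h.symm).limUnder_eq.symm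
  have h₁ : ∀ᶠ z in 𝓝[≠] x, G z = limUnder (𝓝[≠] z) f := by
    filter_upwards [eventually_eventually_nhdsWithin.2 hfG,
      hG.eventually_analyticAt.filter_mono nhdsWithin_le_nhds, self_mem_nhdsWithin] with z hz hGz hne
    refine hlim hGz ?_
    rw [isOpen_compl_singleton.nhdsWithin_eq hne] at hz
    exact hz.filter_mono nhdsWithin_le_nhds
  rw [eventually_nhdsWithin_iff] at h₁
  filter_upwards [h₁] with z hz
  rcases eq_or_ne z x with rfl | hne
  · exact hlim hG hfG
  · exact hz hne

/-- The product of the weight and `h`, with its removable singularities removed. -/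
def jumpEntry (q : ℝ) (h : ℂ → ℂ) (z : ℂ) : ℂ := limUnder (𝓝[≠] z) fun s => weight q s * h s

lemma jumpEntry_eq {q α : ℝ} {h : ℂ → ℂ} (hq0 : 0 < q) (hq1 : q < 1)
    (hh : IsHFunction q α h) {z : ℂ} (hz : z ≠ 0) (hzk : ∀ k : ℤ, z ≠ (q : ℂ) ^ k) :
    jumpEntry q h z = weight q z * h z :=
  (((differentiable_weight hq0 hq1).continuous.continuousAt.mul
    (hh.analyticAt z hz hzk).continuousAt).tendsto.mono_left nhdsWithin_le_nhds).limUnder_eq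

/-- The zeros of the weight at `q ^ k`, `k < 0`, cancel the poles of `h`. -/
lemma analyticAt_jumpEntry {q α : ℝ} {h : ℂ → ℂ} (hq0 : 0 < q) (hq1 : q < 1)
    (hh : IsHFunction q α h) {z : ℂ} (hz : z ≠ 0)
    (hzk : ∀ k : ℤ, 0 ≤ k → z ≠ (q : ℂ) ^ k) : AnalyticAt ℂ (jumpEntry q h) z := by
  have hw : AnalyticAt ℂ (weight q) z := (differentiable_weight hq0 hq1).analyticAt z
  by_cases hk : ∃ k : ℤ, z = (q : ℂ) ^ k
  · obtain ⟨k, rfl⟩ := hk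
    have hk0 : k < 0 := by
      by_contra hk
      exact hzk k (not_lt.1 hk) rfl
    obtain ⟨hm, ho⟩ := hh.simplePole k
    refine analyticAt_limUnder_nhdsNE (hw.meromorphicAt.mul hm) ?_
    have hpos : 0 < meromorphicOrderAt (weight q) ((q : ℂ) ^ k) := by
      rw [← tendsto_zero_iff_meromorphicOrderAt_pos hw.meromorphicAt,
        ← weight_zpow_eq_zero hq0 hk0]
      exact hw.continuousAt.tendsto.mono_left nhdsWithin_le_nhds
    rw [fun_meromorphicOrderAt_mul hw.meromorphicAt hm, ho]
    cases hm : meromorphicOrderAt (weight q) ((q : ℂ) ^ k) with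
    | top => simp
    | coe m =>
      rw [hm] at hpos
      have : 0 < m := by exact_mod_cast hpos
      have : 0 ≤ m + (-1) := by omega
      exact_mod_cast this
  · push Not at hk
    have ha : AnalyticAt ℂ (fun s => weight q s * h s) z := hw.mul (hh.analyticAt z hz hk)
    exact analyticAt_limUnder_nhdsNE ha.meromorphicAt ha.meromorphicOrderAt_nonneg

/-- The functional equation of `h`, combined with that of the weight. At a removable singularity it
holds by continuity. -/
lemma jumpEntry_inv_mul {q α : ℝ} {h : ℂ → ℂ} (hq0 : 0 < q) (hq1 : q < 1)
    (hh : IsHFunction q α h) {z : ℂ} (hz : z ≠ 0)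
    (hzk : ∀ k : ℤ, 0 ≤ k → z ≠ (q : ℂ) ^ k) :
    ((q ^ α : ℝ) : ℂ) * jumpEntry q h ((q : ℂ)⁻¹ * z) = (1 - z) * jumpEntry q h z := by
  have hq : (q : ℂ) ≠ 0 := by exact_mod_cast hq0.ne'
  have hshift {x : ℂ} {k : ℤ} (hx : (q : ℂ)⁻¹ * x = (q : ℂ) ^ k) : x = (q : ℂ) ^ (k + 1) := by
    rw [zpow_add_one₀ hq, ← hx]
    field_simp
  -- Off a countable set the identity follows from the functional equations of the two factors.
  set S : Set ℂ := (insert 0 (Set.range fun k : ℤ => (q : ℂ) ^ k))ᶜ with hS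
  have hdense : Dense S :=
    ((Set.countable_range _).insert 0).dense_compl ℂ
  have hne : (𝓝[S] z).NeBot := mem_closure_iff_nhdsWithin_neBot.1 (hdense z)
  have c₁ : ContinuousAt (jumpEntry q h) z := (analyticAt_jumpEntry hq0 hq1 hh hz hzk).continuousAt
  have c₂ : ContinuousAt (fun z => jumpEntry q h ((q : ℂ)⁻¹ * z)) z := by
    refine ContinuousAt.comp (f := fun z => (q : ℂ)⁻¹ * z)
      (analyticAt_jumpEntry hq0 hq1 hh (by positivity) fun k hk hx => ?_).continuousAt
      (by fun_prop)
    exact hzk (k + 1) (by omega) (hshift hx)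
  have t₁ := (c₂.const_mul ((q ^ α : ℝ) : ℂ)).tendsto.mono_left (nhdsWithin_le_nhds (s := S))
  have c₃ : ContinuousAt (fun z => (1 - z) * jumpEntry q h z) z :=
    (continuousAt_const.sub continuousAt_id).mul c₁
  have t₂ := c₃.tendsto.mono_left (nhdsWithin_le_nhds (s := S))
  refine tendsto_nhds_unique (t₁.congr' ?_) t₂
  filter_upwards [self_mem_nhdsWithin] with x hx
  simp only [hS, Set.mem_compl_iff, Set.mem_insert_iff, Set.mem_range, not_or, not_exists] at hx
  obtain ⟨hx0, hxk⟩ := hx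
  have hy0 : (q : ℂ)⁻¹ * x ≠ 0 := mul_ne_zero (inv_ne_zero hq) hx0
  have hyk : ∀ k : ℤ, (q : ℂ)⁻¹ * x ≠ (q : ℂ) ^ k := fun k hk => hxk _ (hshift hk).symm
  have hmap := hh.map_mul _ hy0 hyk
  rw [mul_inv_cancel_left₀ hq] at hmap
  rw [jumpEntry_eq hq0 hq1 hh hy0 hyk, jumpEntry_eq hq0 hq1 hh hx0 fun k hk => hxk k hk.symm,
    weight_inv_mul hq0 hq1, hmap]
  ring

/-! ### The entire factor of a solution -/

lemma IsRectifiableJordanCurve.isCompact {Γ : Set ℂ} (hΓ : IsRectifiableJordanCurve Γ) :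
    IsCompact Γ := by
  obtain ⟨γ, hc, -, -, -, rfl⟩ := hΓ
  exact isCompact_Icc.image_of_continuousOn hc

lemma isOpen_interiorRegion {Γ : Set ℂ} (hΓ : IsClosed Γ) : IsOpen (interiorRegion Γ) := by
  refine isOpen_iff_mem_nhds.2 fun z hz => ?_
  filter_upwards [(hΓ.isOpen_compl.connectedComponentIn (x := z)).mem_nhds
    (mem_connectedComponentIn hz.1)] with w hw
  exact ⟨connectedComponentIn_subset _ _ hw, connectedComponentIn_eq hw ▸ hz.2⟩

lemma isOpen_exteriorRegion {Γ : Set ℂ} (hΓ : IsClosed Γ) : IsOpen (exteriorRegion Γ) := by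
  refine isOpen_iff_mem_nhds.2 fun z hz => ?_
  filter_upwards [(hΓ.isOpen_compl.connectedComponentIn (x := z)).mem_nhds
    (mem_connectedComponentIn hz.1)] with w hw
  exact ⟨connectedComponentIn_subset _ _ hw, connectedComponentIn_eq hw ▸ hz.2⟩

lemma mem_regions_or_mem (Γ : Set ℂ) (z : ℂ) :
    z ∈ interiorRegion Γ ∨ z ∈ exteriorRegion Γ ∨ z ∈ Γ := by
  simp only [interiorRegion, exteriorRegion, Set.mem_ofPred_eq, Set.mem_compl_iff]
  tauto

lemma not_mem_exteriorRegion {Γ : Set ℂ} {z : ℂ} (hz : z ∈ interiorRegion Γ) :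
    z ∉ exteriorRegion Γ := fun h => h.2 hz.2

/-- Far away from a bounded set every point lies in an unbounded component of the complement, which
contains a radial half-line. -/
lemma eventually_mem_exteriorRegion {Γ : Set ℂ} (hΓ : Bornology.IsBounded Γ) :
    ∀ᶠ z in Bornology.cobounded ℂ, z ∈ exteriorRegion Γ := by
  obtain ⟨R, hR⟩ := hΓ.exists_norm_le
  filter_upwards [tendsto_norm_cobounded_atTop.eventually_gt_atTop (max R 0)] with z hz
  have hz0 : 0 < ‖z‖ := (le_max_right _ _).trans_lt hz
  have hray : (fun t : ℝ => (t : ℂ) * z) '' Set.Ici 1 ⊆ Γᶜ := by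
    rintro _ ⟨t, ht, rfl⟩ hmem
    have h₁ := hR _ hmem
    rw [norm_mul, Complex.norm_real, Real.norm_eq_abs,
      abs_of_pos (zero_lt_one.trans_le ht)] at h₁
    have h₂ : ‖z‖ ≤ t * ‖z‖ := le_mul_of_one_le_left hz0.le ht
    exact absurd ((le_max_left _ _).trans_lt hz) (by linarith)
  have hzray : z ∈ (fun t : ℝ => (t : ℂ) * z) '' Set.Ici 1 := ⟨1, by simp, by simp⟩
  refine ⟨hray hzray, fun hb => ?_⟩
  have hsub := (isPreconnected_Ici.image (fun t : ℝ => (t : ℂ) * z)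
    (by fun_prop)).subset_connectedComponentIn hzray hray
  obtain ⟨C, hC⟩ := (hb.subset hsub).exists_norm_le
  have := hC _ ⟨max 1 ((C + 1) / ‖z‖), Set.mem_Ici.2 (le_max_left _ _), rfl⟩
  rw [norm_mul, Complex.norm_real, Real.norm_eq_abs,
    abs_of_pos (zero_lt_one.trans_le (le_max_left _ _))] at this
  have h₁ : (C + 1) / ‖z‖ * ‖z‖ ≤ max 1 ((C + 1) / ‖z‖) * ‖z‖ := by
    gcongr
    exact le_max_right _ _
  rw [div_mul_cancel₀ _ hz0.ne'] at h₁
  linarith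

lemma IsAppropriate.ne_zero {q : ℝ} {Γ : Set ℂ} (hΓ : IsAppropriate q Γ) {z : ℂ}
    (hz : z ∉ interiorRegion Γ) : z ≠ 0 := by
  rintro rfl
  exact hz hΓ.zero_mem

lemma IsAppropriate.ne_zpow {q : ℝ} {Γ : Set ℂ} (hΓ : IsAppropriate q Γ) {z : ℂ}
    (hz : z ∉ interiorRegion Γ) (k : ℤ) (hk : 0 ≤ k) : z ≠ (q : ℂ) ^ k := by
  rintro rfl
  exact hz (hΓ.inside k hk)

lemma IsAppropriate.ne_zpow_of_mem {q : ℝ} {Γ : Set ℂ} (hΓ : IsAppropriate q Γ) {z : ℂ}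
    (hz : z ∈ Γ) (k : ℤ) : z ≠ (q : ℂ) ^ k := by
  rintro rfl
  rcases le_or_gt 0 k with hk | hk
  · exact (hΓ.inside k hk).1 hz
  · exact (hΓ.outside k hk).1 hz

/-- The unipotent matrix with first row `(1, a, b)`. -/
def unipotent (a b : ℂ) : Matrix (Fin 3) (Fin 3) ℂ :=
  !![1, a, b;
     0, 1, 0;
     0, 0, 1]

lemma unipotent_mul_unipotent_neg (a b : ℂ) : unipotent a b * unipotent (-a) (-b) = 1 := by
  ext i j
  fin_cases i <;> fin_cases j <;> simp [unipotent, Matrix.mul_apply, Fin.sum_univ_three]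

lemma unipotent_neg_mul_unipotent (a b : ℂ) : unipotent (-a) (-b) * unipotent a b = 1 := by
  simpa using unipotent_mul_unipotent_neg (-a) (-b)

lemma det_unipotent (a b : ℂ) : (unipotent a b).det = 1 := by
  simp [unipotent, Matrix.det_fin_three]

/-- Commutation of the jump matrix with the diagonal factor, as a condition on the entries. -/
lemma unipotent_mul_diagonal {a b a' b' s u v : ℂ} (ha : u * a' = s * a) (hb : v * b' = s * b) :
    unipotent a' b' * Matrix.diagonal ![s, u, v] = Matrix.diagonal ![s, u, v] * unipotent a b := by
  ext i j
  fin_cases i <;> fin_cases j <;> simp [unipotent, ← ha, ← hb, mul_comm]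

lemma differentiableAt_unipotent_apply {f g : ℂ → ℂ} {z : ℂ} (hf : DifferentiableAt ℂ f z)
    (hg : DifferentiableAt ℂ g z) (i j : Fin 3) :
    DifferentiableAt ℂ (fun z => unipotent (f z) (g z) i j) z := by
  fin_cases i <;> fin_cases j <;> simp [unipotent, hf, hg]

lemma differentiableAt_mul_apply {A B : ℂ → Matrix (Fin 3) (Fin 3) ℂ} {z : ℂ}
    (hA : ∀ i j, DifferentiableAt ℂ (fun z => A z i j) z)
    (hB : ∀ i j, DifferentiableAt ℂ (fun z => B z i j) z) (i j : Fin 3) :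
    DifferentiableAt ℂ (fun z => (A z * B z) i j) z := by
  simp only [Matrix.mul_apply]
  exact DifferentiableAt.fun_sum fun k _ => (hA i k).mul (hB k j)

lemma differentiableAt_det {A : ℂ → Matrix (Fin 3) (Fin 3) ℂ} {z : ℂ}
    (hA : ∀ i j, DifferentiableAt ℂ (fun z => A z i j) z) :
    DifferentiableAt ℂ (fun z => (A z).det) z := by
  simp only [Matrix.det_apply']
  exact DifferentiableAt.fun_sum fun k _ =>
    (differentiableAt_const _).mul (DifferentiableAt.fun_finsetProd fun l _ => hA _ _)

lemma differentiableAt_adjugate_apply {A : ℂ → Matrix (Fin 3) (Fin 3) ℂ} {z : ℂ}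
    (hA : ∀ i j, DifferentiableAt ℂ (fun z => A z i j) z) (i j : Fin 3) :
    DifferentiableAt ℂ (fun z => (A z).adjugate i j) z := by
  simp only [Matrix.adjugate_apply]
  refine differentiableAt_det fun k l => ?_
  by_cases hk : k = j
  · subst hk
    simp
  · simpa [Matrix.updateRow_ne hk] using hA k l

lemma continuousAt_matrix_of_differentiableAt {A : ℂ → Matrix (Fin 3) (Fin 3) ℂ} {z : ℂ}
    (hA : ∀ i j, DifferentiableAt ℂ (fun z => A z i j) z) : ContinuousAt A z :=
  continuousAt_pi.2 fun i => continuousAt_pi.2 fun j => (hA i j).continuousAt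

/-- A solution of the Riemann-Hilbert problem is an entire matrix function inside the curve, and the
same entire function multiplied by the continued jump matrix outside. -/
theorem IsRHPSolution.exists_entire {q α β : ℝ} (hq0 : 0 < q) (hq1 : q < 1) {h₁ h₂ : ℂ → ℂ}
    (hh₁ : IsHFunction q α h₁) (hh₂ : IsHFunction q β h₂) {Γ : Set ℂ} (hΓ : IsAppropriate q Γ)
    {n : ℕ} {Y : ℂ → Matrix (Fin 3) (Fin 3) ℂ} (hY : IsRHPSolution q h₁ h₂ Γ n Y) :
    ∃ E : ℂ → Matrix (Fin 3) (Fin 3) ℂ, (∀ i j, Differentiable ℂ fun z => E z i j) ∧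
      (∀ z ∈ interiorRegion Γ, Y z = E z) ∧
      ∀ z ∈ exteriorRegion Γ, Y z = E z * unipotent (jumpEntry q h₁ z) (jumpEntry q h₂ z) := by
  classical
  obtain ⟨Ym, Yp, hYm, -, hbd⟩ := hY.boundary
  have hcl : IsClosed Γ := hΓ.jordan.isCompact.isClosed
  have hint := isOpen_interiorRegion hcl
  have hext := isOpen_exteriorRegion hcl
  set J : ℂ → Matrix (Fin 3) (Fin 3) ℂ := fun z =>
    unipotent (-jumpEntry q h₁ z) (-jumpEntry q h₂ z) with hJ
  have hJd : ∀ z ∉ interiorRegion Γ, ∀ i j, DifferentiableAt ℂ (fun z => J z i j) z := by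
    intro z hz i j
    have hz0 := hΓ.ne_zero hz
    have hzk := hΓ.ne_zpow hz
    exact differentiableAt_unipotent_apply
      (analyticAt_jumpEntry hq0 hq1 hh₁ hz0 hzk).differentiableAt.neg
      (analyticAt_jumpEntry hq0 hq1 hh₂ hz0 hzk).differentiableAt.neg i j
  have hYd : ∀ z ∈ Γᶜ, ∀ i j, DifferentiableAt ℂ (fun z => Y z i j) z :=
    fun z hz i j => (hY.analytic i j z hz).differentiableAt
  -- The values of `Y` on `Γ` are arbitrary and have to be replaced by boundary values.
  set E : ℂ → Matrix (Fin 3) (Fin 3) ℂ := fun z =>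
    if z ∈ interiorRegion Γ then Y z else if z ∈ exteriorRegion Γ then Y z * J z else Ym z with hE
  have hEint : ∀ z ∈ interiorRegion Γ, E z = Y z := fun z hz => by simp [hE, hz]
  have hEext : ∀ z ∈ exteriorRegion Γ, E z = Y z * J z := fun z hz => by
    have : z ∉ interiorRegion Γ := fun h => not_mem_exteriorRegion h hz
    simp [hE, hz, this]
  have hEΓ : ∀ z ∈ Γ, E z = Ym z := fun z hz => by
    have h₁ : z ∉ interiorRegion Γ := fun h => h.1 hz
    have h₂ : z ∉ exteriorRegion Γ := fun h => h.1 hz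
    simp [hE, h₁, h₂]
  have hEd : ∀ z ∈ Γᶜ, ∀ i j, DifferentiableAt ℂ (fun z => E z i j) z := by
    intro z hz i j
    rcases mem_regions_or_mem Γ z with h | h | h
    · refine (hYd z hz i j).congr_of_eventuallyEq ?_
      filter_upwards [hint.mem_nhds h] with w hw
      rw [hEint w hw]
    · refine (differentiableAt_mul_apply (hYd z hz)
        (hJd z fun h' => not_mem_exteriorRegion h' h) i j).congr_of_eventuallyEq ?_
      filter_upwards [hext.mem_nhds h] with w hw
      rw [hEext w hw]
    · exact absurd h hz
  have hEc : Continuous E := by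
    refine continuous_iff_continuousAt.2 fun s => ?_
    by_cases hs : s ∈ Γ
    swap
    · exact continuousAt_matrix_of_differentiableAt (hEd s hs)
    have hs' : s ∉ interiorRegion Γ := fun h => h.1 hs
    obtain ⟨b₁, b₂, b₃⟩ := hbd s hs
    have hunion : interiorRegion Γ ∪ (exteriorRegion Γ ∪ Γ) = Set.univ :=
      Set.eq_univ_of_forall (mem_regions_or_mem Γ)
    rw [ContinuousAt, hEΓ s hs, ← nhdsWithin_univ, ← hunion, nhdsWithin_union, nhdsWithin_union]
    refine Tendsto.sup ?_ (Tendsto.sup ?_ ?_)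
    · refine b₁.congr' ?_
      filter_upwards [self_mem_nhdsWithin] with w hw
      rw [hEint w hw]
    · have hJs : Tendsto J (𝓝[exteriorRegion Γ] s) (𝓝 (J s)) :=
        (continuousAt_matrix_of_differentiableAt (hJd s hs')).tendsto.mono_left nhdsWithin_le_nhds
      -- On the curve the continued jump matrix is the jump matrix, so its inverse undoes the jump.
      have hval : Yp s * J s = Ym s := by
        have hjump : jump q h₁ h₂ s = unipotent (jumpEntry q h₁ s) (jumpEntry q h₂ s) := by
          rw [jumpEntry_eq hq0 hq1 hh₁ (hΓ.ne_zero hs') (hΓ.ne_zpow_of_mem hs),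
            jumpEntry_eq hq0 hq1 hh₂ (hΓ.ne_zero hs') (hΓ.ne_zpow_of_mem hs)]
          rfl
        rw [b₃, hjump, hJ, mul_assoc, unipotent_mul_unipotent_neg, mul_one]
      rw [← hval]
      refine (b₂.mul hJs).congr' ?_
      filter_upwards [self_mem_nhdsWithin] with w hw
      rw [hEext w hw]
    · refine (hYm s hs).tendsto.congr' ?_
      filter_upwards [self_mem_nhdsWithin] with w hw
      rw [hEΓ w hw]
  refine ⟨E, fun i j => ?_, fun z hz => (hEint z hz).symm, fun z hz => ?_⟩
  · exact hΓ.jordan.differentiable_of_differentiableOn_compl (hEc.matrix_elem i j)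
      fun z hz => (hEd z hz i j).differentiableWithinAt
  · rw [hEext z hz, hJ, mul_assoc, unipotent_neg_mul_unipotent, mul_one]

/-! ### Behaviour at infinity -/

/-- Liouville's theorem for an entire function that is bounded near infinity. -/
lemma apply_eq_apply_of_isBigO_one {f : ℂ → ℂ} (hf : Differentiable ℂ f)
    (hO : f =O[Bornology.cobounded ℂ] fun _ => (1 : ℂ)) (z w : ℂ) : f z = f w := by
  refine hf.apply_eq_apply_of_bounded ?_ z w
  obtain ⟨C, hC⟩ := hO.bound
  have hK : Bornology.IsBounded {z | ‖f z‖ ≤ C * ‖(1 : ℂ)‖}ᶜ := Bornology.isBounded_def.2 (by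
    rw [compl_compl]
    exact hC)
  have hcomp : IsCompact (f '' closure {z | ‖f z‖ ≤ C * ‖(1 : ℂ)‖}ᶜ) :=
    hK.isCompact_closure.image hf.continuous
  refine (hcomp.isBounded.union (Metric.isBounded_closedBall (x := (0 : ℂ)) (r := C))).subset ?_
  rintro _ ⟨z, rfl⟩
  by_cases hz : ‖f z‖ ≤ C * ‖(1 : ℂ)‖
  · exact Or.inr (by simpa using hz)
  · exact Or.inl ⟨z, subset_closure hz, rfl⟩

lemma isBigO_inv_one :
    (fun z : ℂ => z⁻¹) =O[Bornology.cobounded ℂ] fun _ => (1 : ℂ) :=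
  tendsto_inv₀_cobounded.isBigO_one ℂ

lemma tendsto_one_of_isBigO_inv {M : ℂ → Matrix (Fin 3) (Fin 3) ℂ}
    (hM : ∀ i j, (fun z => (M z - 1) i j) =O[Bornology.cobounded ℂ] fun z => z⁻¹) :
    Tendsto M (Bornology.cobounded ℂ) (𝓝 1) := by
  refine tendsto_pi_nhds.2 fun i => tendsto_pi_nhds.2 fun j => ?_
  have := ((hM i j).trans_tendsto tendsto_inv₀_cobounded).add_const
    ((1 : Matrix (Fin 3) (Fin 3) ℂ) i j)
  simpa using this

/-- If `M = I + O(1/z)` has determinant `1`, then its inverse is `I + O(1/z)` too. -/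
lemma isBigO_adjugate_sub_one {M : ℂ → Matrix (Fin 3) (Fin 3) ℂ}
    (hM : ∀ i j, (fun z => (M z - 1) i j) =O[Bornology.cobounded ℂ] fun z => z⁻¹)
    (hdet : ∀ᶠ z in Bornology.cobounded ℂ, (M z).det = 1) (i j : Fin 3) :
    (fun z => ((M z).adjugate - 1) i j) =O[Bornology.cobounded ℂ] fun z => z⁻¹ := by
  have hN : Tendsto (fun z => (M z).adjugate) (Bornology.cobounded ℂ)
      (𝓝 (1 : Matrix (Fin 3) (Fin 3) ℂ).adjugate) :=
    ((continuous_id.matrix_adjugate).tendsto 1).comp (tendsto_one_of_isBigO_inv hM)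
  have hNO (k : Fin 3) : (fun z => (M z).adjugate k j) =O[Bornology.cobounded ℂ]
      fun _ => (1 : ℂ) :=
    (tendsto_pi_nhds.1 (tendsto_pi_nhds.1 hN k) j).isBigO_one ℂ
  have hsum : (fun z => -∑ k, (M z - 1) i k * (M z).adjugate k j) =O[Bornology.cobounded ℂ]
      fun z : ℂ => z⁻¹ :=
    (IsBigO.fun_sum fun k _ => by simpa using (hM i k).mul (hNO k)).neg_left
  refine hsum.congr' ?_ EventuallyEq.rfl
  filter_upwards [hdet] with z hz
  have : (M z).adjugate - 1 = -((M z - 1) * (M z).adjugate) := by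
    rw [sub_mul, Matrix.mul_adjugate, hz, one_smul, one_mul, neg_sub]
  rw [this, Matrix.neg_apply, Matrix.mul_apply]

/-- The entries of `M diag(g) N - diag(g)`, where `M` and `N` are `I + O(1/z)` and `g = O(z)`. -/
lemma isBigO_mul_diagonal_mul_sub {M N : ℂ → Matrix (Fin 3) (Fin 3) ℂ} {g : ℂ → Fin 3 → ℂ}
    {w : ℂ → ℂ}
    (hM : ∀ i j, (fun z => (M z - 1) i j) =O[Bornology.cobounded ℂ] fun z => z⁻¹)
    (hN : ∀ i j, (fun z => (N z - 1) i j) =O[Bornology.cobounded ℂ] fun z => z⁻¹)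
    (hg : ∀ i, (fun z => g z i) =O[Bornology.cobounded ℂ] fun z => z)
    (hw : (fun z : ℂ => z⁻¹) =O[Bornology.cobounded ℂ] w) {i j : Fin 3}
    (hi : (fun z => z⁻¹ * g z i) =O[Bornology.cobounded ℂ] w)
    (hj : (fun z => z⁻¹ * g z j) =O[Bornology.cobounded ℂ] w) :
    (fun z => (M z * Matrix.diagonal (g z) * N z - Matrix.diagonal (g z)) i j)
      =O[Bornology.cobounded ℂ] w := by
  have e (z : ℂ) : (M z * Matrix.diagonal (g z) * N z - Matrix.diagonal (g z)) i j =
      (M z - 1) i j * g z j + (N z - 1) i j * g z i +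
        ∑ k, (M z - 1) i k * g z k * (N z - 1) k j := by
    have : M z * Matrix.diagonal (g z) * N z - Matrix.diagonal (g z) =
        (M z - 1) * Matrix.diagonal (g z) + Matrix.diagonal (g z) * (N z - 1) +
          (M z - 1) * Matrix.diagonal (g z) * (N z - 1) := by noncomm_ring
    rw [this, Matrix.add_apply, Matrix.add_apply, Matrix.mul_diagonal, Matrix.diagonal_mul,
      Matrix.mul_apply]
    simp only [Matrix.mul_diagonal, mul_comm (g z i)]
  simp only [e]
  refine (IsBigO.add ?_ ?_).add (IsBigO.fun_sum fun k _ => ?_)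
  · exact ((hM i j).mul (isBigO_refl _ _)).trans hj
  · exact ((hN i j).mul (isBigO_refl _ _)).trans hi
  · refine (((hM i k).mul (hg k)).mul (hN k j)).trans (IsBigO.trans ?_ hw)
    refine IsBigO.of_bound 1 (.of_forall fun z => ?_)
    rcases eq_or_ne z 0 with rfl | hz
    · simp
    · simp [hz]

lemma det_normalization {n : ℕ} {z : ℂ} (hz : z ≠ 0) :
    (Matrix.diagonal ![z ^ (-2 * (n : ℤ)), z ^ n, z ^ n]).det = 1 := by
  rw [Matrix.det_diagonal, Fin.prod_univ_three]
  change z ^ (-2 * (n : ℤ)) * z ^ n * z ^ n = 1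
  rw [← zpow_natCast, ← zpow_add₀ hz, ← zpow_add₀ hz,
    show -2 * (n : ℤ) + n + n = 0 by ring, zpow_zero]

lemma tendsto_inv_mul_cobounded {q : ℝ} (hq0 : 0 < q) :
    Tendsto (fun z : ℂ => (q : ℂ)⁻¹ * z) (Bornology.cobounded ℂ) (Bornology.cobounded ℂ) :=
  tendsto_mul_left_cobounded (inv_ne_zero (by exact_mod_cast hq0.ne'))

lemma det_eq_one_of_tendsto {E M : ℂ → Matrix (Fin 3) (Fin 3) ℂ}
    (hE : ∀ i j, Differentiable ℂ fun z => E z i j)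
    (hM : ∀ i j, (fun z => (M z - 1) i j) =O[Bornology.cobounded ℂ] fun z => z⁻¹)
    (hdet : ∀ᶠ z in Bornology.cobounded ℂ, (M z).det = (E z).det) (z : ℂ) : (E z).det = 1 := by
  have hd : Differentiable ℂ fun z => (E z).det :=
    fun z => differentiableAt_det fun i j => hE i j z
  refine hd.apply_eq_of_tendsto_cocompact z ?_
  rw [← Metric.cobounded_eq_cocompact, ← Matrix.det_one (n := Fin 3) (R := ℂ)]
  exact (((continuous_id.matrix_det).tendsto (1 : Matrix (Fin 3) (Fin 3) ℂ)).comp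
    (tendsto_one_of_isBigO_inv hM)).congr' hdet

/-! ### The Lax matrix -/

/-- The Lax matrix in terms of the entire factor `E` of `Y`. As `det E = 1`, the inverse of `E` is
written as the adjugate, which is visibly entire. -/
def laxMatrix (q α β : ℝ) (E : ℂ → Matrix (Fin 3) (Fin 3) ℂ) (z : ℂ) :
    Matrix (Fin 3) (Fin 3) ℂ :=
  shifted q α β E z * (E z).adjugate

lemma isLaxMatrix_laxMatrix {q α β : ℝ} (hq0 : 0 < q) (hq1 : q < 1) {h₁ h₂ : ℂ → ℂ}
    (hh₁ : IsHFunction q α h₁) (hh₂ : IsHFunction q β h₂) {Γ : Set ℂ} (hΓ : IsAppropriate q Γ)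
    {Y E : ℂ → Matrix (Fin 3) (Fin 3) ℂ} (hE : ∀ i j, Differentiable ℂ fun z => E z i j)
    (hint : ∀ z ∈ interiorRegion Γ, Y z = E z)
    (hext : ∀ z ∈ exteriorRegion Γ,
      Y z = E z * unipotent (jumpEntry q h₁ z) (jumpEntry q h₂ z))
    (hdet : ∀ z, (E z).det = 1) : IsLaxMatrix q α β Γ Y (laxMatrix q α β E) where
  entire i j := by
    intro z
    refine differentiableAt_mul_apply (fun k l => differentiableAt_mul_apply (fun k l => ?_)
      (fun k l => ?_) k l) (fun k l => differentiableAt_adjugate_apply (fun k l => hE k l z) k l) i j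
    · exact (hE k l).comp (f := fun z => (q : ℂ)⁻¹ * z) (by fun_prop) z
    · fin_cases k <;> fin_cases l <;> simp; fun_prop
  eq_of_inside z hz hz' := by
    have hinv : (E z)⁻¹ = (E z).adjugate :=
      Matrix.inv_eq_right_inv (by rw [Matrix.mul_adjugate, hdet, one_smul])
    refine ⟨by simp [hint z hz, hdet], ?_⟩
    rw [laxMatrix, shifted, shifted, hint z hz, hint _ hz', hinv]
  eq_of_outside z hz hz' := by
    have hz₀ : z ∉ interiorRegion Γ := fun h => not_mem_exteriorRegion h hz
    have hz0 := hΓ.ne_zero hz₀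
    have hzk := hΓ.ne_zpow hz₀
    have hinv : (Y z)⁻¹ =
        unipotent (-jumpEntry q h₁ z) (-jumpEntry q h₂ z) * (E z).adjugate := by
      refine Matrix.inv_eq_right_inv ?_
      rw [hext z hz, mul_assoc, ← mul_assoc (unipotent _ _), unipotent_mul_unipotent_neg, one_mul,
        Matrix.mul_adjugate, hdet, one_smul]
    refine ⟨by simp [hext z hz, hdet, det_unipotent], ?_⟩
    -- The jump matrix is intertwined by the diagonal factor, so that it cancels.
    rw [laxMatrix, shifted, shifted, hinv, hext _ hz', mul_assoc (E _) (unipotent _ _),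
      unipotent_mul_diagonal (jumpEntry_inv_mul hq0 hq1 hh₁ hz0 hzk)
        (jumpEntry_inv_mul hq0 hq1 hh₂ hz0 hzk), mul_assoc (E _), mul_assoc (E _),
      mul_assoc (Matrix.diagonal _), ← mul_assoc (unipotent _ _), unipotent_mul_unipotent_neg,
      one_mul, ← mul_assoc]

/-- Two Lax matrices agree near `0`, which lies inside the curve, hence everywhere. -/
lemma IsLaxMatrix.eq {q α β : ℝ} {Γ : Set ℂ} (hΓ : IsAppropriate q Γ)
    {Y D D' : ℂ → Matrix (Fin 3) (Fin 3) ℂ} (hD : IsLaxMatrix q α β Γ Y D)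
    (hD' : IsLaxMatrix q α β Γ Y D') : D = D' := by
  have hint := isOpen_interiorRegion hΓ.jordan.isCompact.isClosed
  have hnear : ∀ᶠ z in 𝓝 (0 : ℂ), D z = D' z := by
    have hc : Tendsto (fun z : ℂ => (q : ℂ)⁻¹ * z) (𝓝 0) (𝓝 0) :=
      (continuous_const_mul (q : ℂ)⁻¹).tendsto' _ _ (by simp)
    filter_upwards [hint.mem_nhds hΓ.zero_mem, hc (hint.mem_nhds hΓ.zero_mem)] with z h₁ h₂
    rw [(hD.eq_of_inside z h₁ h₂).2, (hD'.eq_of_inside z h₁ h₂).2]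
  ext z i j
  refine congrFun (AnalyticOnNhd.eq_of_eventuallyEq (𝕜 := ℂ) (f := fun z => D z i j)
    (g := fun z => D' z i j) (z₀ := 0) (fun z _ => (hD.entire i j).analyticAt z)
    (fun z _ => (hD'.entire i j).analyticAt z) ?_) z
  filter_upwards [hnear] with z hz
  simp only [hz]

/-- A Lax matrix of a solution of degree `n` equals `diag(q⁻²ⁿ (1 - z), qⁿ q ^ α, qⁿ q ^ β)`, up to
a constant matrix whose lower right `2 × 2` block vanishes. -/
lemma IsLaxMatrix.exists_const {q α β : ℝ} (hq0 : 0 < q) {h₁ h₂ : ℂ → ℂ} {Γ : Set ℂ}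
    (hΓ : IsAppropriate q Γ) {n : ℕ} {Y D : ℂ → Matrix (Fin 3) (Fin 3) ℂ}
    (hY : IsRHPSolution q h₁ h₂ Γ n Y) (hdet : ∀ z ∈ exteriorRegion Γ, (Y z).det = 1)
    (hD : IsLaxMatrix q α β Γ Y D) :
    ∃ C : Matrix (Fin 3) (Fin 3) ℂ, (∀ i ≠ 0, ∀ j ≠ 0, C i j = 0) ∧
      ∀ z, D z = C + Matrix.diagonal ![(q : ℂ) ^ (-2 * (n : ℤ)) * (1 - z),
        (q : ℂ) ^ n * ((q ^ α : ℝ) : ℂ), (q : ℂ) ^ n * ((q ^ β : ℝ) : ℂ)] := by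
  have hq : (q : ℂ) ≠ 0 := by exact_mod_cast hq0.ne'
  set g : ℂ → Fin 3 → ℂ := fun z => ![(q : ℂ) ^ (-2 * (n : ℤ)) * (1 - z),
    (q : ℂ) ^ n * ((q ^ α : ℝ) : ℂ), (q : ℂ) ^ n * ((q ^ β : ℝ) : ℂ)] with hg
  set Δ : ℂ → Matrix (Fin 3) (Fin 3) ℂ :=
    fun z => Matrix.diagonal ![z ^ (-2 * (n : ℤ)), z ^ n, z ^ n] with hΔ
  set M : ℂ → Matrix (Fin 3) (Fin 3) ℂ := fun z => Y z * Δ z with hM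
  have hMO : ∀ i j, (fun z => (M z - 1) i j) =O[Bornology.cobounded ℂ] fun z => z⁻¹ := hY.decay
  have hMqO : ∀ i j, (fun z => (M ((q : ℂ)⁻¹ * z) - 1) i j) =O[Bornology.cobounded ℂ]
      fun z => z⁻¹ := fun i j => by
    refine ((hMO i j).comp_tendsto (tendsto_inv_mul_cobounded hq0)).trans ?_
    have : ((fun z : ℂ => z⁻¹) ∘ fun z => (q : ℂ)⁻¹ * z) = fun z => (q : ℂ) * z⁻¹ := by
      funext z
      simp [mul_comm]
    rw [this]
    exact isBigO_const_mul_self _ _ _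
  have hext := eventually_mem_exteriorRegion hΓ.jordan.isCompact.isBounded
  have hne : ∀ᶠ z in Bornology.cobounded ℂ, z ≠ (0 : ℂ) := Bornology.eventually_ne_cobounded 0
  have hMdet : ∀ᶠ z in Bornology.cobounded ℂ, (M z).det = 1 := by
    filter_upwards [hext, hne] with z hz hz0
    rw [hM, Matrix.det_mul, hdet z hz, det_normalization hz0, one_mul]
  have hform : ∀ᶠ z in Bornology.cobounded ℂ,
      D z = M ((q : ℂ)⁻¹ * z) * Matrix.diagonal (g z) * (M z).adjugate := by
    filter_upwards [hext, (tendsto_inv_mul_cobounded hq0).eventually hext, hne, hMdet]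
      with z hz hz' hz0 hzM
    have hDY : D z * Y z = shifted q α β Y z := by
      obtain ⟨hu, hDz⟩ := hD.eq_of_outside z hz hz'
      rw [hDz, mul_assoc, Matrix.nonsing_inv_mul _ hu, mul_one]
    have hcomm : Matrix.diagonal ![1 - z, ((q ^ α : ℝ) : ℂ), ((q ^ β : ℝ) : ℂ)] * Δ z =
        Δ ((q : ℂ)⁻¹ * z) * Matrix.diagonal (g z) := by
      simp only [hΔ, hg, Matrix.diagonal_mul_diagonal]
      congr 1
      funext i
      fin_cases i
      · simp [mul_zpow]
        field_simp
      · simp [mul_pow]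
        field_simp
      · simp [mul_pow]
        field_simp
    have hDM : D z * M z = M ((q : ℂ)⁻¹ * z) * Matrix.diagonal (g z) := by
      rw [hM]
      simp only
      rw [← mul_assoc, hDY, shifted, mul_assoc, hcomm, ← mul_assoc]
    rw [← hDM, mul_assoc, Matrix.mul_adjugate, hzM, one_smul, mul_one]
  have hN := isBigO_adjugate_sub_one hMO hMdet
  have hgd (i : Fin 3) : Differentiable ℂ fun z => g z i := by
    fin_cases i <;> simp [hg]; fun_prop
  have hone : (fun _ : ℂ => (1 : ℂ)) =O[Bornology.cobounded ℂ] fun z => z :=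
    (isLittleO_const_id_cobounded (1 : ℂ)).isBigO
  have hg0 {i : Fin 3} (hi : i ≠ 0) :
      (fun z => g z i) =O[Bornology.cobounded ℂ] fun _ => (1 : ℂ) := by
    have : ∃ k : ℂ, (fun z => g z i) = fun _ => k := by
      fin_cases i
      · exact absurd rfl hi
      · exact ⟨_, rfl⟩
      · exact ⟨_, rfl⟩
    obtain ⟨k, hk⟩ := this
    rw [hk]
    exact isBigO_const_const k one_ne_zero _
  have hgO (i : Fin 3) : (fun z => g z i) =O[Bornology.cobounded ℂ] fun z => z := by
    rcases eq_or_ne i 0 with rfl | hi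
    · exact (hone.sub (isBigO_refl _ _)).const_mul_left _
    · exact (hg0 hi).trans hone
  have hinvO {f u : ℂ → ℂ} (hf : f =O[Bornology.cobounded ℂ] u) :
      (fun z => z⁻¹ * f z) =O[Bornology.cobounded ℂ] fun z => z⁻¹ * u z :=
    (isBigO_refl _ _).mul hf
  have hinv1 : (fun z : ℂ => z⁻¹ * z) =O[Bornology.cobounded ℂ] fun _ => (1 : ℂ) := by
    refine IsBigO.of_bound 1 (.of_forall fun z => ?_)
    rcases eq_or_ne z 0 with rfl | hz
    · simp
    · simp [hz]
  set F : ℂ → Matrix (Fin 3) (Fin 3) ℂ := fun z => D z - Matrix.diagonal (g z) with hF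
  have hFd (i j : Fin 3) : Differentiable ℂ fun z => F z i j := by
    simp only [hF, Matrix.sub_apply, Matrix.diagonal_apply]
    refine (hD.entire i j).sub ?_
    split_ifs
    · exact hgd i
    · exact differentiable_const 0
  have hFeq (i j : Fin 3) : (fun z => (M ((q : ℂ)⁻¹ * z) * Matrix.diagonal (g z) * (M z).adjugate
      - Matrix.diagonal (g z)) i j) =ᶠ[Bornology.cobounded ℂ] fun z => F z i j := by
    filter_upwards [hform] with z hz
    rw [hF, ← hz]
  have hFO (i j : Fin 3) : (fun z => F z i j) =O[Bornology.cobounded ℂ] fun _ => (1 : ℂ) :=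
    (isBigO_mul_diagonal_mul_sub hMqO hN hgO isBigO_inv_one ((hinvO (hgO i)).trans hinv1)
      ((hinvO (hgO j)).trans hinv1)).congr' (hFeq i j) EventuallyEq.rfl
  refine ⟨F 0, fun i hi j hj => ?_, fun z => ?_⟩
  · -- In the lower right block the diagonal factor is bounded, which improves `O(1)` to `O(1/z)`.
    have hO : (fun z => F z i j) =O[Bornology.cobounded ℂ] fun z => z⁻¹ :=
      (isBigO_mul_diagonal_mul_sub hMqO hN hgO (isBigO_refl _ _)
        (by simpa using hinvO (hg0 hi)) (by simpa using hinvO (hg0 hj))).congr' (hFeq i j)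
        EventuallyEq.rfl
    refine (hFd i j).apply_eq_of_tendsto_cocompact 0 ?_
    rw [← Metric.cobounded_eq_cocompact]
    exact hO.trans_tendsto tendsto_inv₀_cobounded
  · have : F z = F 0 := by
      ext i j
      exact apply_eq_apply_of_isBigO_one (hFd i j) (hFO i j) z 0
    rw [← this]
    exact (sub_add_cancel _ _).symm

/-! ### Eigenvalues and the off-diagonal products -/

lemma hasEigenvalue_toLin'_iff_det (A : Matrix (Fin 3) (Fin 3) ℂ) (c : ℂ) :
    Module.End.HasEigenvalue (Matrix.toLin' A) c ↔ (c • 1 - A).det = 0 := by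
  rw [Module.End.hasEigenvalue_iff_isRoot_charpoly, Matrix.charpoly_toLin', Polynomial.IsRoot,
    Matrix.eval_charpoly, Matrix.smul_one_eq_diagonal]
  rfl

lemma det_smul_one_sub_laxMatrix_zero {q α β : ℝ} {E : ℂ → Matrix (Fin 3) (Fin 3) ℂ}
    (hdet : ∀ z, (E z).det = 1) (c : ℂ) :
    (c • 1 - laxMatrix q α β E 0).det =
      (c - 1) * (c - ((q ^ α : ℝ) : ℂ)) * (c - ((q ^ β : ℝ) : ℂ)) := by
  have h : c • 1 - laxMatrix q α β E 0 =
      E 0 * Matrix.diagonal ![c - 1, c - ((q ^ α : ℝ) : ℂ), c - ((q ^ β : ℝ) : ℂ)] *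
        (E 0).adjugate := by
    have hd : Matrix.diagonal ![c - 1, c - ((q ^ α : ℝ) : ℂ), c - ((q ^ β : ℝ) : ℂ)] =
        c • 1 - Matrix.diagonal ![1 - 0, ((q ^ α : ℝ) : ℂ), ((q ^ β : ℝ) : ℂ)] := by
      ext i j
      fin_cases i <;> fin_cases j <;> simp
    rw [hd, laxMatrix, shifted, mul_zero, mul_sub, sub_mul, Matrix.mul_smul, mul_one,
      Matrix.smul_mul, Matrix.mul_adjugate, hdet, one_smul]
  rw [h, Matrix.det_mul, Matrix.det_mul, Matrix.det_adjugate, hdet, Matrix.det_diagonal]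
  simp [Fin.prod_univ_three]

/-- A matrix whose lower right block is `diag(A, B)` is determined, up to the splitting of the
products of opposite entries, by its characteristic polynomial. -/
lemma entries_of_charpoly {m₁ m₂ m₃ m₄ m₅ A B a b : ℂ} (hAB : A ≠ B)
    (h : ∀ c : ℂ, (c • 1 - !![m₁, m₂, m₃; m₄, A, 0; m₅, 0, B] : Matrix (Fin 3) (Fin 3) ℂ).det =
      (c - 1) * (c - a) * (c - b)) :
    m₁ = 1 + a + b - A - B ∧ m₂ * m₄ = (A - 1) * (A - a) * (A - b) / (B - A) ∧
      m₃ * m₅ = (B - 1) * (B - a) * (B - b) / (A - B) := by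
  have h' (c : ℂ) : (c - m₁) * (c - A) * (c - B) - m₂ * m₄ * (c - B) - m₃ * m₅ * (c - A) =
      (c - 1) * (c - a) * (c - b) := by
    rw [← h c]
    simp [Matrix.det_fin_three]
    ring
  have hBA : B - A ≠ 0 := sub_ne_zero.2 hAB.symm
  have hAB' : A - B ≠ 0 := sub_ne_zero.2 hAB
  refine ⟨?_, ?_, ?_⟩
  · -- The second difference isolates the coefficient of `c ^ 2`, that is, the trace.
    linear_combination (-1 / 2) * (h' 1 + h' (-1) - 2 * h' 0)
  · rw [eq_div_iff hBA]
    linear_combination h' A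
  · rw [eq_div_iff hAB']
    linear_combination h' B

end QLax
end

theorem mainTheorem3 (q : ℝ) (hq0 : 0 < q) (hq1 : q < 1)
    (α β : ℝ) (hα : ∀ k : ℤ, α ≠ k) (hβ : ∀ k : ℤ, β ≠ k) (hαβ : ∀ k : ℤ, α - β ≠ k)
    (h₁ h₂ : ℂ → ℂ) (hh₁ : QLax.IsHFunction q α h₁) (hh₂ : QLax.IsHFunction q β h₂)
    (Γ : Set ℂ) (hΓ : QLax.IsAppropriate q Γ)
    (n : ℕ) (Y : ℂ → Matrix (Fin 3) (Fin 3) ℂ) (hY : QLax.IsRHPSolution q h₁ h₂ Γ n Y) :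
    (∃! D : ℂ → Matrix (Fin 3) (Fin 3) ℂ, QLax.IsLaxMatrix q α β Γ Y D) ∧
    ∀ D : ℂ → Matrix (Fin 3) (Fin 3) ℂ, QLax.IsLaxMatrix q α β Γ Y D →
      (∀ c : ℂ, Module.End.HasEigenvalue (Matrix.toLin' (D 0)) c ↔
        c = 1 ∨ c = ((q ^ α : ℝ) : ℂ) ∨ c = ((q ^ β : ℝ) : ℂ)) ∧
      ∃ μ₁ μ₂ μ₃ μ₄ μ₅ : ℂ,
        (∀ z : ℂ, D z =
          !![μ₁ - z * (q : ℂ) ^ (-2 * (n : ℤ)), μ₂, μ₃;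
             μ₄, ((q ^ ((n : ℝ) + α) : ℝ) : ℂ), 0;
             μ₅, 0, ((q ^ ((n : ℝ) + β) : ℝ) : ℂ)]) ∧
        μ₁ = ((1 + q ^ α + q ^ β - q ^ (α + n) - q ^ (β + n) : ℝ) : ℂ) ∧
        μ₂ * μ₄ = ((q ^ (α - n) * (q ^ n - 1) * (q ^ (α + n) - 1) * (q ^ (α + n) - q ^ β)
          / (q ^ β - q ^ α) : ℝ) : ℂ) ∧
        μ₃ * μ₅ = ((q ^ (β - n) * (q ^ n - 1) * (q ^ (β + n) - 1) * (q ^ (β + n) - q ^ α)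
          / (q ^ α - q ^ β) : ℝ) : ℂ) := by
  obtain ⟨E, hE, hint, hext⟩ := hY.exists_entire hq0 hq1 hh₁ hh₂ hΓ
  have hfar := QLax.eventually_mem_exteriorRegion hΓ.jordan.isCompact.isBounded
  have hdet : ∀ z, (E z).det = 1 := by
    refine QLax.det_eq_one_of_tendsto hE hY.decay ?_
    filter_upwards [hfar, Bornology.eventually_ne_cobounded (0 : ℂ)] with z hz hz0
    rw [hext z hz, Matrix.det_mul, Matrix.det_mul, QLax.det_unipotent,
      QLax.det_normalization hz0, mul_one, mul_one]
  have hlax := QLax.isLaxMatrix_laxMatrix hq0 hq1 hh₁ hh₂ hΓ hE hint hext hdet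
  refine ⟨⟨_, hlax, fun D hD => hD.eq hΓ hlax⟩, fun D hD => ?_⟩
  have hYdet : ∀ z ∈ QLax.exteriorRegion Γ, (Y z).det = 1 := fun z hz => by
    rw [hext z hz, Matrix.det_mul, hdet, QLax.det_unipotent, one_mul]
  have hchar (c : ℂ) : (c • 1 - D 0).det =
      (c - 1) * (c - ((q ^ α : ℝ) : ℂ)) * (c - ((q ^ β : ℝ) : ℂ)) := by
    rw [hD.eq hΓ hlax, QLax.det_smul_one_sub_laxMatrix_zero hdet]
  refine ⟨fun c => ?_, ?_⟩
  · rw [QLax.hasEigenvalue_toLin'_iff_det, hchar, mul_eq_zero, mul_eq_zero, sub_eq_zero,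
      sub_eq_zero, sub_eq_zero, or_assoc]
  obtain ⟨C, hC, hDC⟩ := hD.exists_const hq0 hΓ hY hYdet
  have hαn : q ^ (α + n) = q ^ α * q ^ n := by rw [Real.rpow_add hq0, Real.rpow_natCast]
  have hβn : q ^ (β + n) = q ^ β * q ^ n := by rw [Real.rpow_add hq0, Real.rpow_natCast]
  have hαn' : q ^ (α - n) = q ^ α / q ^ n := by rw [Real.rpow_sub hq0, Real.rpow_natCast]
  have hβn' : q ^ (β - n) = q ^ β / q ^ n := by rw [Real.rpow_sub hq0, Real.rpow_natCast]
  have hform : ∀ z : ℂ, D z =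
      !![C 0 0 + (q : ℂ) ^ (-2 * (n : ℤ)) - z * (q : ℂ) ^ (-2 * (n : ℤ)), C 0 1, C 0 2;
         C 1 0, ((q ^ ((n : ℝ) + α) : ℝ) : ℂ), 0;
         C 2 0, 0, ((q ^ ((n : ℝ) + β) : ℝ) : ℂ)] := by
    intro z
    rw [hDC z, add_comm (n : ℝ) α, add_comm (n : ℝ) β, hαn, hβn]
    ext i j
    fin_cases i <;> fin_cases j <;> simp [hC] <;> ring
  have hne : q ^ α ≠ q ^ β := fun h => by
    have := (Real.rpow_right_inj hq0 hq1.ne).1 h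
    exact hαβ 0 (by simp [this])
  have hqn : q ^ n ≠ 0 := pow_ne_zero _ hq0.ne'
  have hAB : ((q ^ ((n : ℝ) + α) : ℝ) : ℂ) ≠ ((q ^ ((n : ℝ) + β) : ℝ) : ℂ) := by
    rw [add_comm (n : ℝ) α, add_comm (n : ℝ) β, hαn, hβn]
    exact_mod_cast fun h => hne (mul_right_cancel₀ hqn h)
  have hD0 := hform 0
  rw [zero_mul, sub_zero] at hD0
  rw [hD0] at hchar
  obtain ⟨e₁, e₂, e₃⟩ := QLax.entries_of_charpoly hAB hchar
  refine ⟨_, _, _, _, _, hform, ?_, ?_, ?_⟩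
  · rw [e₁, add_comm (n : ℝ) α, add_comm (n : ℝ) β]
    push_cast
    ring
  · rw [e₂, add_comm (n : ℝ) α, add_comm (n : ℝ) β, hαn, hβn, hαn']
    norm_cast
    have d₁ : q ^ β * q ^ n - q ^ α * q ^ n ≠ 0 := by
      rw [← sub_mul]; exact mul_ne_zero (sub_ne_zero.2 hne.symm) hqn
    have d₂ : q ^ β - q ^ α ≠ 0 := sub_ne_zero.2 hne.symm
    rw [div_eq_div_iff d₁ d₂]
    field_simp
  · rw [e₃, add_comm (n : ℝ) α, add_comm (n : ℝ) β, hαn, hβn, hβn']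
    norm_cast
    have d₁ : q ^ α * q ^ n - q ^ β * q ^ n ≠ 0 := by
      rw [← sub_mul]; exact mul_ne_zero (sub_ne_zero.2 hne) hqn
    have d₂ : q ^ α - q ^ β ≠ 0 := sub_ne_zero.2 hne
    rw [div_eq_div_iff d₁ d₂]
    field_simp
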